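/- Let $n,k\ge 0$, let $\mathcal A=\{\alpha_1,\dots,\alpha_{n+k+1}\}\subseteq\mathbb R^n$ be a set of $n+k+1$ distinct points whose convex hull has dimension $n$, and let $\varepsilon\in\{\pm1\}^{n+k+1}$. Put $\mathcal A_{\pm}=\{\alpha_i : \varepsilon_i=\pm1\}$ and $\mathbb R^{\mathcal A}_\varepsilon=\{c\in\mathbb R^{n+k+1} : \operatorname{sign}(c_i)=\varepsilon_i \text{ for all } i\}$. For $c\in\mathbb R^{\mathcal A}_\varepsilon$ let $f_c(x)=\sum_{i=1}^{n+k+1}c_i e^{\alpha_i\cdot x}$ for $x\in\mathbb R^n$, and let $\operatorname{Sing}(f_c)$ be the set of its singular zeros, that is, of the $x\in\mathbb R^n$ with $f_c(x)=\frac{\partial f_c}{\partial x_1}(x)=\dots=\frac{\partial f_c}{\partial x_n}(x)=0$. Let $B\in\mathbb R^{(n+k+1)\times k}$ be a Gale dual matrix of $\mathcal A$, that is, a matrix whose columns form a basis of the kernel of the $(n+1)\times(n+k+1)$ matrix with columns $\binom{1}{\alpha_i}$. The signed reduced $A$-discriminant is $$\Gamma_\varepsilon(A,B)=\{B^\top(\log|c_1|,\dots,\log|c_{n+k+1}|)^\top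 : c\in\mathbb R^{\mathcal A}_\varepsilon,\ \operatorname{Sing}(f_c)\neq\emptyset\}\subseteq\mathbb R^k.$$ Let $P\subseteq\mathbb R^n$ be an $n$-simplex with vertices $\mu_0,\dots,\mu_n$, and let $P^-=\bigcup_{j=0}^n P^{-,j}$ be the union of its negative vertex cones $P^{-,j}=\mu_j+\operatorname{Cone}(\mu_j-\mu_0,\dots,\mu_j-\mu_n)$. Suppose that $\mathcal A_+\subseteq P$, $\mathcal A_-\subseteq P^-$ and $\mathcal A\cap\operatorname{int}(P\cup P^-)\neq\emptyset$. Then: (i) for every $c\in\mathbb R^{\mathcal A}_\varepsilon$ and every $x\in\operatorname{Sing}(f_c)$, the Hessian matrix of $f_c$ at $x$ is negative definite; that is, all its eigenvalues are negative; (ii) if $\mathcal A$ has codimension $k=2$, then the complement $\mathbb R^2\setminus\Gamma_\varepsilon(A,B)$ has at most two connected components. -/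

import Mathlib

namespace ExpSum

/-- The exponential sum `f_c(x) = ∑ i, c i * exp (α i ⬝ x)` with exponent vectors `α i`. -/
noncomputable def expSum {n m : ℕ} (α : Fin m → Fin n → ℝ) (c : Fin m → ℝ) (x : Fin n → ℝ) : ℝ :=
  ∑ i, c i * Real.exp (α i ⬝ᵥ x)

/-- The partial derivative `∂f/∂x_i`. -/
noncomputable def partialDeriv {n : ℕ} (i : Fin n) (f : (Fin n → ℝ) → ℝ) (x : Fin n → ℝ) : ℝ :=
  fderiv ℝ f x (Pi.single i 1)

/-- The Hessian matrix of `f` at `x`. -/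
noncomputable def hessian {n : ℕ} (f : (Fin n → ℝ) → ℝ) (x : Fin n → ℝ) :
    Matrix (Fin n) (Fin n) ℝ :=
  Matrix.of fun i j => partialDeriv i (partialDeriv j f) x

/-- The set of singular zeros of `f`. -/
def singularZeros {n : ℕ} (f : (Fin n → ℝ) → ℝ) : Set (Fin n → ℝ) :=
  {x | f x = 0 ∧ ∀ i, partialDeriv i f x = 0}

/-- The orthant of all coefficient vectors with sign distribution `ε`. -/
def orthant {m : ℕ} (ε : Fin m → SignType) : Set (Fin m → ℝ) :=
  {c | ∀ i, SignType.sign (c i) = ε i}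

/-- The positive exponent vectors. -/
def posExponents {n m : ℕ} (α : Fin m → Fin n → ℝ) (ε : Fin m → SignType) : Set (Fin n → ℝ) :=
  {a | ∃ i, ε i = 1 ∧ α i = a}

/-- The negative exponent vectors. -/
def negExponents {n m : ℕ} (α : Fin m → Fin n → ℝ) (ε : Fin m → SignType) : Set (Fin n → ℝ) :=
  {a | ∃ i, ε i = -1 ∧ α i = a}

/-- The convex hull of the exponent vectors has dimension `n`. -/
def FullDimensional {n m : ℕ} (α : Fin m → Fin n → ℝ) : Prop :=
  Module.finrank ℝ (vectorSpan ℝ (convexHull ℝ (Set.range α))) = n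

/-- The matrix with columns `(1, α i)`. -/
def hatMatrix {n m : ℕ} (α : Fin m → Fin n → ℝ) : Matrix (Fin (n + 1)) (Fin m) ℝ :=
  Matrix.of fun r i => Fin.cons (α := fun _ => ℝ) 1 (α i) r

/-- `B` is a Gale dual matrix: its columns form a basis of the kernel of the matrix with
columns `(1, α i)`. -/
def IsGaleDual {n m k : ℕ} (α : Fin m → Fin n → ℝ) (B : Matrix (Fin m) (Fin k) ℝ) : Prop :=
  LinearIndependent ℝ B.col ∧
    Submodule.span ℝ (Set.range B.col) = LinearMap.ker (hatMatrix α).mulVecLin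

/-- The signed discriminant: coefficient vectors with signs `ε` whose exponential sum has a
singular zero. -/
def signedDiscriminant {n m : ℕ} (α : Fin m → Fin n → ℝ) (ε : Fin m → SignType) :
    Set (Fin m → ℝ) :=
  {c | c ∈ orthant ε ∧ (singularZeros (expSum α c)).Nonempty}

/-- The signed reduced discriminant `Γ_ε(A, B) = Bᵀ Log |∇_{A,ε}|`. -/
noncomputable def signedReducedDiscriminant {n m k : ℕ} (α : Fin m → Fin n → ℝ)
    (ε : Fin m → SignType) (B : Matrix (Fin m) (Fin k) ℝ) : Set (Fin k → ℝ) :=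
  (fun c : Fin m → ℝ => B.transpose.mulVec fun i => Real.log |c i|) '' signedDiscriminant α ε

/-- The simplex as a set of points. -/
def simplexSet {n : ℕ} (P : Affine.Simplex ℝ (Fin n → ℝ) n) : Set (Fin n → ℝ) :=
  convexHull ℝ (Set.range P.points)

/-- The negative vertex cone `μ_k + Cone(μ_k - μ_0, …, μ_k - μ_n)` at the vertex `μ_k`. -/
def negVertexCone {n : ℕ} (P : Affine.Simplex ℝ (Fin n → ℝ) n) (k : Fin (n + 1)) :
    Set (Fin n → ℝ) :=
  {x | ∃ t : Fin (n + 1) → ℝ, (∀ j, 0 ≤ t j) ∧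
    x = P.points k + ∑ j, t j • (P.points k - P.points j)}

/-- The union of all negative vertex cones. -/
def negVertexCones {n : ℕ} (P : Affine.Simplex ℝ (Fin n → ℝ) n) : Set (Fin n → ℝ) :=
  ⋃ k, negVertexCone P k

end ExpSum

/-! At a singular zero `x` the weights `w i = c i * exp (α i ⬝ x)` have signs `ε` and form an affine
dependency of the exponents, so they also annihilate each barycentric coordinate with respect to
`P`. For strictly convex `φ`, compare `φ (α i ⬝ v)` with the affine interpolation of the values of
`φ` at the vertices. On `P` the difference is nonpositive by Jensen. On `P⁻`, where at most one
coordinate is positive, Jensen reverses. So `w i` times the difference is always nonpositive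
(`weight_mul_gap`), and the interpolation terms cancel in the sum, giving `∑ w i * φ (α i ⬝ v) ≤ 0`.

With `φ = y ^ 2` this sum is the Hessian form; an exponent with no vanishing coordinate makes it
strictly negative. With `φ = exp` it is `f_c (x + v)`, so a singular zero is a global maximum with
value 0. The complement of the discriminant therefore consists of the classes positive somewhere and
those negative everywhere. Since `Bᵀ Log` ignores translations of the variables, each is the
continuous image of a convex set of coefficients. -/

namespace ExpSum

/-! ### Jensen's inequality and its reverse, with `ψ a` the slope of the supporting line at `a`. -/

section Jensen

variable {ι : Type*} [Fintype ι] {φ ψ : ℝ → ℝ}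

/-- The weighted gaps between `φ` and its supporting line at `a`. -/
theorem sum_mul_supporting_gap (φ ψ : ℝ → ℝ) {l : ι → ℝ} (hl : ∑ j, l j = 1)
    (y : ι → ℝ) (a : ℝ) :
    ∑ j, l j * (φ (y j) - φ a - ψ a * (y j - a)) =
      ∑ j, l j * φ (y j) - φ a - ψ a * (∑ j, l j * y j - a) := by
  have h : ∀ j, l j * (φ (y j) - φ a - ψ a * (y j - a)) =
      l j * φ (y j) - l j * (φ a - ψ a * a) - ψ a * (l j * y j) := fun j => by ring
  simp only [h, Finset.sum_sub_distrib, ← Finset.sum_mul, ← Finset.mul_sum, hl]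
  ring

/-- Jensen's inequality for a function with strictly supporting lines, with the equality case. -/
theorem jensen_of_nonneg (hφ : ∀ a y, y ≠ a → 0 < φ y - φ a - ψ a * (y - a))
    {l : ι → ℝ} (hl : ∑ j, l j = 1) (h0 : ∀ j, 0 ≤ l j) (y : ι → ℝ) :
    φ (∑ j, l j * y j) ≤ ∑ j, l j * φ (y j) ∧
      (φ (∑ j, l j * y j) = ∑ j, l j * φ (y j) → (∀ j, l j ≠ 0) → ∃ a, ∀ j, y j = a) := by
  set Y := ∑ j, l j * y j with hY
  have hgap : ∀ j, 0 ≤ φ (y j) - φ Y - ψ Y * (y j - Y) := fun j => by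
    by_cases h : y j = Y
    · simp [h]
    · exact (hφ _ _ h).le
  have hid := sum_mul_supporting_gap φ ψ hl y Y
  rw [← hY, sub_self, mul_zero, sub_zero] at hid
  have hterm : ∀ j ∈ Finset.univ, 0 ≤ l j * (φ (y j) - φ Y - ψ Y * (y j - Y)) :=
    fun j _ => mul_nonneg (h0 j) (hgap j)
  refine ⟨by linarith [Finset.sum_nonneg hterm], fun he hne => ⟨Y, fun j => ?_⟩⟩
  by_contra h
  have := (Finset.sum_eq_zero_iff_of_nonneg hterm).1 (by linarith) j (Finset.mem_univ j)
  rcases mul_eq_zero.1 this with h1 | h1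
  · exact hne j h1
  · exact (hφ _ _ h).ne' h1

/-- The reversed Jensen inequality for affine combinations with at most one positive weight,
with the equality case. -/
theorem jensen_of_nonpos (hφ : ∀ a y, y ≠ a → 0 < φ y - φ a - ψ a * (y - a))
    {l : ι → ℝ} (hl : ∑ j, l j = 1) (k : ι) (h0 : ∀ j, j ≠ k → l j ≤ 0) (y : ι → ℝ) :
    ∑ j, l j * φ (y j) ≤ φ (∑ j, l j * y j) ∧
      (φ (∑ j, l j * y j) = ∑ j, l j * φ (y j) → (∀ j, l j ≠ 0) → ∃ a, ∀ j, y j = a) := by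
  set Y := ∑ j, l j * y j with hY
  have hgap : ∀ z, 0 ≤ φ z - φ (y k) - ψ (y k) * (z - y k) := fun z => by
    by_cases h : z = y k
    · simp [h]
    · exact (hφ _ _ h).le
  -- Supporting at `y k` rather than at the mean kills the only term whose weight may be positive.
  have hid := sum_mul_supporting_gap φ ψ hl y (y k)
  rw [← hY] at hid
  have hterm : ∀ j ∈ Finset.univ, l j * (φ (y j) - φ (y k) - ψ (y k) * (y j - y k)) ≤ 0 := by
    intro j _
    by_cases h : j = k
    · simp [h]
    · exact mul_nonpos_of_nonpos_of_nonneg (h0 j h) (hgap _)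
  have hsum := Finset.sum_nonpos hterm
  refine ⟨by linarith [hgap Y], fun he hne => ⟨y k, fun j => ?_⟩⟩
  by_contra h
  have := (Finset.sum_eq_zero_iff_of_nonpos hterm).1 (by linarith [hgap Y]) j (Finset.mem_univ j)
  rcases mul_eq_zero.1 this with h1 | h1
  · exact hne j h1
  · exact (hφ _ _ h).ne' h1

end Jensen

/-! ### Barycentric coordinates on `P` and `P⁻`. -/

section Simplex

variable {n : ℕ} (P : Affine.Simplex ℝ (Fin n → ℝ) n)

/-- The vertices of a full-dimensional simplex as an affine basis. -/
noncomputable def simplexBasis : AffineBasis (Fin (n + 1)) ℝ (Fin n → ℝ) :=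
  ⟨P.points, P.independent, P.span_eq_top (by simp)⟩

theorem simplexBasis_apply (j : Fin (n + 1)) : simplexBasis P j = P.points j := rfl

theorem mem_simplexSet_iff {x : Fin n → ℝ} :
    x ∈ simplexSet P ↔ ∀ j, 0 ≤ (simplexBasis P).coord j x := by
  have := (simplexBasis P).convexHull_eq_nonneg_coord
  exact Set.ext_iff.1 this x

theorem coord_eq_linear (j : Fin (n + 1)) (x : Fin n → ℝ) :
    (simplexBasis P).coord j x =
      ((simplexBasis P).coord j).linear x + (simplexBasis P).coord j 0 := by
  conv_lhs => rw [AffineMap.decomp ((simplexBasis P).coord j)]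
  rfl

theorem coord_add_smul (j p q : Fin (n + 1)) (x : Fin n → ℝ) (t : ℝ) :
    (simplexBasis P).coord j (x + t • (P.points p - P.points q)) =
      (simplexBasis P).coord j x +
        t * ((if j = p then 1 else 0) - (if j = q then 1 else 0)) := by
  have hp := (simplexBasis P).coord_apply j p
  have hq := (simplexBasis P).coord_apply j q
  rw [simplexBasis_apply, coord_eq_linear] at hp hq
  rw [coord_eq_linear, coord_eq_linear P j x, map_add, map_smul, map_sub, ← hp, ← hq, smul_eq_mul]
  ring

theorem coord_nonpos_of_mem_negVertexCone {k : Fin (n + 1)} {x : Fin n → ℝ}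
    (hx : x ∈ negVertexCone P k) {j : Fin (n + 1)} (hj : j ≠ k) :
    (simplexBasis P).coord j x ≤ 0 := by
  obtain ⟨t, ht, rfl⟩ := hx
  have h1 : ∀ p, ((simplexBasis P).coord j).linear (P.points p) =
      (if j = p then 1 else 0) - (simplexBasis P).coord j 0 := fun p => by
    rw [← (simplexBasis P).coord_apply j p, simplexBasis_apply, coord_eq_linear]; ring
  rw [coord_eq_linear, map_add, map_sum]
  simp only [map_smul, map_sub, h1, smul_eq_mul, if_neg hj]
  have : ∀ p, t p * ((0 - (simplexBasis P).coord j 0) -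
      ((if j = p then 1 else 0) - (simplexBasis P).coord j 0)) = -(if j = p then t p else 0) := by
    intro p; split_ifs <;> ring
  simp only [this, Finset.sum_neg_distrib, Finset.sum_ite_eq, Finset.mem_univ, if_true]
  linarith [ht j]

theorem sum_coord_mul_dotProduct (x v : Fin n → ℝ) :
    ∑ j, (simplexBasis P).coord j x * (P.points j ⬝ᵥ v) = x ⬝ᵥ v := by
  conv_rhs => rw [← (simplexBasis P).linear_combination_coord_eq_self x]
  simp [sum_dotProduct, smul_dotProduct, simplexBasis_apply]

/-- A linear form constant on the vertices is constant on the whole space; compare its values at `0`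
and at `v`. -/
theorem eq_zero_of_dotProduct_points_eq {v : Fin n → ℝ} {a : ℝ}
    (h : ∀ j, P.points j ⬝ᵥ v = a) : v = 0 := by
  have key : ∀ x : Fin n → ℝ, x ⬝ᵥ v = a := fun x => by
    rw [← sum_coord_mul_dotProduct P x v]
    simp only [h, ← Finset.sum_mul, (simplexBasis P).sum_coord_apply_eq_one, one_mul]
  have h0 : a = 0 := by rw [← key 0, zero_dotProduct]
  exact dotProduct_self_eq_zero.1 ((key v).trans h0)

/-- Points of `P` have no negative coordinate, points of `P⁻` at most one positive one. -/
theorem notMem_of_coord_signs {x : Fin n → ℝ} {a b c : Fin (n + 1)} (hab : a ≠ b)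
    (ha : 0 < (simplexBasis P).coord a x) (hb : 0 < (simplexBasis P).coord b x)
    (hc : (simplexBasis P).coord c x < 0) : x ∉ simplexSet P ∪ negVertexCones P := by
  rintro (h | h)
  · exact absurd ((mem_simplexSet_iff P).1 h c) (not_le.2 hc)
  · obtain ⟨k, hk⟩ := Set.mem_iUnion.1 h
    by_cases hak : a = k
    · exact absurd (coord_nonpos_of_mem_negVertexCone P hk (j := b) (by rintro rfl; exact hab hak))
        (not_le.2 hb)
    · exact absurd (coord_nonpos_of_mem_negVertexCone P hk hak) (not_le.2 ha)

theorem exists_pos_add_smul_mem {s : Set (Fin n → ℝ)} {x : Fin n → ℝ} (hx : x ∈ interior s)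
    (v : Fin n → ℝ) : ∃ t : ℝ, 0 < t ∧ x + t • v ∈ s := by
  have hc : Filter.Tendsto (fun t : ℝ => x + t • v) (nhdsWithin 0 (Set.Ioi 0)) (nhds x) := by
    have : Continuous fun t : ℝ => x + t • v := by fun_prop
    simpa using (this.tendsto 0).mono_left nhdsWithin_le_nhds
  have h1 := hc.eventually (mem_interior_iff_mem_nhds.1 hx)
  obtain ⟨t, ht, hpos⟩ := (h1.and self_mem_nhdsWithin).exists
  exact ⟨t, hpos, ht⟩

/-- In dimension at least two, no barycentric coordinate of an interior point of `P ∪ P⁻`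
vanishes. -/
theorem coord_ne_zero_of_mem_interior (hn : 2 ≤ n) {x : Fin n → ℝ}
    (hx : x ∈ interior (simplexSet P ∪ negVertexCones P)) (a : Fin (n + 1)) :
    (simplexBasis P).coord a x ≠ 0 := by
  intro ha
  obtain ⟨b, hb⟩ : ∃ b, 0 < (simplexBasis P).coord b x := by
    by_contra! h
    have := Finset.sum_nonpos fun j (_ : j ∈ Finset.univ) => h j
    rw [(simplexBasis P).sum_coord_apply_eq_one] at this
    linarith
  have hab : a ≠ b := by rintro rfl; exact hb.ne' ha
  obtain ⟨c, hc⟩ : ∃ c, c ∉ ({a, b} : Finset (Fin (n + 1))) := by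
    by_contra! h
    have h1 := Finset.card_le_card (fun j _ => h j : Finset.univ ⊆ {a, b})
    have h2 := Finset.card_le_two (a := a) (b := b)
    simp only [Finset.card_univ, Fintype.card_fin] at h1
    omega
  simp only [Finset.mem_insert, Finset.mem_singleton, not_or] at hc
  obtain ⟨hca, hcb⟩ := hc
  -- A small move along the edge direction between vertices `a` and `c` produces two positive
  -- coordinates and a negative one, which leaves `P ∪ P⁻`.
  rcases le_or_gt 0 ((simplexBasis P).coord c x) with h | h
  · obtain ⟨t, ht, hmem⟩ := exists_pos_add_smul_mem hx (P.points c - P.points a)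
    refine notMem_of_coord_signs P hcb (c := a) ?_ ?_ ?_ hmem <;>
      simp [coord_add_smul, ha, hca, Ne.symm hca, hab.symm, Ne.symm hcb] <;> linarith
  · obtain ⟨t, ht, hmem⟩ := exists_pos_add_smul_mem hx (P.points a - P.points c)
    refine notMem_of_coord_signs P hab (c := c) ?_ ?_ ?_ hmem <;>
      simp [coord_add_smul, ha, hca, Ne.symm hca, hab.symm, Ne.symm hcb] <;> linarith

end Simplex

theorem ne_zero_of_mem_orthant {m : ℕ} {ε : Fin m → SignType} (hε : ∀ i, ε i = 1 ∨ ε i = -1)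
    {c : Fin m → ℝ} (hc : c ∈ orthant ε) (i : Fin m) : c i ≠ 0 := fun h0 => by
  have := hc i
  rw [h0, sign_zero] at this
  rcases hε i with h | h <;> simp [h] at this

/-! ### Affine dependencies with sign pattern `ε`. -/

section Weights

variable {n m : ℕ} (P : Affine.Simplex ℝ (Fin n → ℝ) n) {α : Fin m → Fin n → ℝ}
  {ε : Fin m → SignType} {w : Fin m → ℝ} {φ ψ : ℝ → ℝ}

theorem sum_mul_coord_eq_zero (h0 : ∑ i, w i = 0) (h1 : ∀ j, ∑ i, w i * α i j = 0)
    (l : Fin (n + 1)) : ∑ i, w i * (simplexBasis P).coord l (α i) = 0 := by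
  have hv : ∑ i, w i • α i = 0 := by
    ext j; simpa [Finset.sum_apply] using h1 j
  have hlin : ∑ i, w i * ((simplexBasis P).coord l).linear (α i) = 0 := by
    have := congrArg ((simplexBasis P).coord l).linear hv
    simpa [map_sum] using this
  simp only [fun i => coord_eq_linear P l (α i), mul_add, Finset.sum_add_distrib, hlin,
    ← Finset.sum_mul, h0, zero_mul, add_zero]

theorem weight_mul_gap (hφ : ∀ a y, y ≠ a → 0 < φ y - φ a - ψ a * (y - a))
    (hε : ∀ i, ε i = 1 ∨ ε i = -1) (hpos : posExponents α ε ⊆ simplexSet P)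
    (hneg : negExponents α ε ⊆ negVertexCones P) (hw : w ∈ orthant ε) (v : Fin n → ℝ)
    (i : Fin m) :
    w i * (φ (α i ⬝ᵥ v) - ∑ l, (simplexBasis P).coord l (α i) * φ (P.points l ⬝ᵥ v)) ≤ 0 ∧
    (w i * (φ (α i ⬝ᵥ v) - ∑ l, (simplexBasis P).coord l (α i) * φ (P.points l ⬝ᵥ v)) = 0 →
      (∀ l, (simplexBasis P).coord l (α i) ≠ 0) → v = 0) := by
  have hsum := (simplexBasis P).sum_coord_apply_eq_one (α i)
  rw [← sum_coord_mul_dotProduct P (α i) v]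
  rcases hε i with h | h
  · have hwi : 0 < w i := sign_eq_one_iff.1 ((hw i).trans h)
    obtain ⟨hle, heq⟩ := jensen_of_nonneg hφ hsum
      ((mem_simplexSet_iff P).1 (hpos ⟨i, h, rfl⟩)) fun l => P.points l ⬝ᵥ v
    refine ⟨mul_nonpos_of_nonneg_of_nonpos hwi.le (by linarith), fun h0 hne => ?_⟩
    obtain ⟨a, ha⟩ :=
      heq (sub_eq_zero.1 ((mul_eq_zero.1 h0).resolve_left hwi.ne')) hne
    exact eq_zero_of_dotProduct_points_eq P ha
  · have hwi : w i < 0 := sign_eq_neg_one_iff.1 ((hw i).trans h)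
    obtain ⟨k, hk⟩ := Set.mem_iUnion.1 (hneg ⟨i, h, rfl⟩)
    obtain ⟨hle, heq⟩ := jensen_of_nonpos hφ hsum k
      (fun j hj => coord_nonpos_of_mem_negVertexCone P hk hj) fun l => P.points l ⬝ᵥ v
    refine ⟨mul_nonpos_of_nonpos_of_nonneg hwi.le (by linarith), fun h0 hne => ?_⟩
    obtain ⟨a, ha⟩ :=
      heq (sub_eq_zero.1 ((mul_eq_zero.1 h0).resolve_left hwi.ne)) hne
    exact eq_zero_of_dotProduct_points_eq P ha

theorem sum_weight_mul_eq (h0 : ∑ i, w i = 0) (h1 : ∀ j, ∑ i, w i * α i j = 0)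
    (v : Fin n → ℝ) :
    ∑ i, w i * (φ (α i ⬝ᵥ v) - ∑ l, (simplexBasis P).coord l (α i) * φ (P.points l ⬝ᵥ v)) =
      ∑ i, w i * φ (α i ⬝ᵥ v) := by
  have : ∑ i, w i * ∑ l, (simplexBasis P).coord l (α i) * φ (P.points l ⬝ᵥ v) = 0 := by
    simp only [Finset.mul_sum, ← mul_assoc]
    rw [Finset.sum_comm]
    simp only [← Finset.sum_mul, sum_mul_coord_eq_zero P h0 h1, zero_mul, Finset.sum_const_zero]
  simp only [mul_sub, Finset.sum_sub_distrib, this, sub_zero]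

theorem sum_weight_mul_nonpos (hφ : ∀ a y, y ≠ a → 0 < φ y - φ a - ψ a * (y - a))
    (hε : ∀ i, ε i = 1 ∨ ε i = -1) (hpos : posExponents α ε ⊆ simplexSet P)
    (hneg : negExponents α ε ⊆ negVertexCones P) (hw : w ∈ orthant ε)
    (h0 : ∑ i, w i = 0) (h1 : ∀ j, ∑ i, w i * α i j = 0) (v : Fin n → ℝ) :
    ∑ i, w i * φ (α i ⬝ᵥ v) ≤ 0 := by
  rw [← sum_weight_mul_eq P h0 h1]
  exact Finset.sum_nonpos fun i _ => (weight_mul_gap P hφ hε hpos hneg hw v i).1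

/-- An affine dependency of the exponents with signs `ε` involves an exponent none of whose
barycentric coordinates vanish. -/
theorem exists_coord_ne_zero (hα : Function.Injective α) (hn : n ≠ 0)
    (hint : (Set.range α ∩ interior (simplexSet P ∪ negVertexCones P)).Nonempty)
    (hw : ∀ i, w i ≠ 0) (h0 : ∑ i, w i = 0) (h1 : ∀ j, ∑ i, w i * α i j = 0) :
    ∃ i, ∀ l, (simplexBasis P).coord l (α i) ≠ 0 := by
  obtain ⟨_, ⟨i, rfl⟩, hi⟩ := hint
  rcases Nat.lt_or_ge n 2 with hn2 | hn2
  · obtain rfl : n = 1 := by omega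
    by_contra! h
    have hvertex : ∀ i', ∃ l, α i' = simplexBasis P l := by
      intro i'
      have hs := (simplexBasis P).sum_coord_apply_eq_one (α i')
      obtain ⟨l, hl⟩ := h i'
      rw [Fin.sum_univ_two] at hs
      fin_cases l
      · refine ⟨1, (simplexBasis P).ext_elem fun j => ?_⟩
        simp only [Fin.zero_eta] at hl
        fin_cases j <;> simp <;> linarith
      · refine ⟨0, (simplexBasis P).ext_elem fun j => ?_⟩
        simp only [Fin.mk_one] at hl
        fin_cases j <;> simp <;> linarith
    obtain ⟨l, hl⟩ := hvertex i
    have hs := sum_mul_coord_eq_zero P h0 h1 l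
    rw [Finset.sum_eq_single i] at hs
    · rw [hl, AffineBasis.coord_apply_eq, mul_one] at hs
      exact hw i hs
    · intro i' _ hne
      obtain ⟨l', hl'⟩ := hvertex i'
      have : l ≠ l' := by rintro rfl; exact hne (hα (hl'.trans hl.symm))
      rw [hl', AffineBasis.coord_apply_ne _ this, mul_zero]
    · simp
  · exact ⟨i, coord_ne_zero_of_mem_interior P hn2 hi⟩

theorem sum_weight_mul_sq_neg (hα : Function.Injective α)
    (hε : ∀ i, ε i = 1 ∨ ε i = -1) (hpos : posExponents α ε ⊆ simplexSet P)
    (hneg : negExponents α ε ⊆ negVertexCones P)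
    (hint : (Set.range α ∩ interior (simplexSet P ∪ negVertexCones P)).Nonempty)
    (hw : w ∈ orthant ε)
    (h0 : ∑ i, w i = 0) (h1 : ∀ j, ∑ i, w i * α i j = 0) {v : Fin n → ℝ} (hv : v ≠ 0) :
    ∑ i, w i * (α i ⬝ᵥ v) ^ 2 < 0 := by
  have hn : n ≠ 0 := by rintro rfl; exact hv (Subsingleton.elim _ _)
  obtain ⟨i, hi⟩ := exists_coord_ne_zero P hα hn hint (ne_zero_of_mem_orthant hε hw) h0 h1
  have hφ : ∀ a y : ℝ, y ≠ a → 0 < y ^ 2 - a ^ 2 - 2 * a * (y - a) := fun a y h => by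
    have := sq_pos_of_ne_zero (sub_ne_zero.2 h)
    linarith
  have hgap := weight_mul_gap P (φ := fun y => y ^ 2) (ψ := fun a => 2 * a) hφ hε hpos hneg hw v
  rw [← sum_weight_mul_eq P (φ := fun y => y ^ 2) h0 h1]
  exact Finset.sum_neg' (fun i _ => (hgap i).1)
    ⟨i, Finset.mem_univ i, lt_of_le_of_ne (hgap i).1 fun h => hv ((hgap i).2 h hi)⟩

end Weights

/-! ### Derivatives of exponential sums and singular zeros as maxima. -/

section Calculus

variable {n m : ℕ} (α : Fin m → Fin n → ℝ) (c : Fin m → ℝ)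

theorem hasFDerivAt_expSum (x : Fin n → ℝ) :
    HasFDerivAt (expSum α c)
      (∑ i, (c i * Real.exp (α i ⬝ᵥ x)) •
        LinearMap.toContinuousLinearMap (dotProductBilin ℝ ℝ (α i))) x := by
  unfold expSum
  refine HasFDerivAt.fun_sum fun i _ => ?_
  have h := ((LinearMap.toContinuousLinearMap (dotProductBilin ℝ ℝ (α i))).hasFDerivAt
    (x := x)).exp.const_mul (c i)
  rw [smul_smul] at h
  exact h

theorem partialDeriv_expSum (j : Fin n) :
    partialDeriv j (expSum α c) = expSum α fun i => c i * α i j := by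
  ext x
  rw [partialDeriv, (hasFDerivAt_expSum α c x).fderiv]
  simp [expSum, mul_right_comm]

theorem dotProduct_hessian_mulVec (x v : Fin n → ℝ) :
    v ⬝ᵥ (hessian (expSum α c) x).mulVec v =
      ∑ i, c i * Real.exp (α i ⬝ᵥ x) * (α i ⬝ᵥ v) ^ 2 := by
  simp only [hessian, partialDeriv_expSum, dotProduct, Matrix.mulVec, Matrix.of_apply, expSum,
    Finset.mul_sum, Finset.sum_mul, sq]
  rw [Finset.sum_congr rfl fun _ _ => Finset.sum_comm, Finset.sum_comm]
  refine Finset.sum_congr rfl fun i _ => Finset.sum_congr rfl fun j _ =>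
    Finset.sum_congr rfl fun l _ => ?_
  ring

theorem hessian_isSymm (x : Fin n → ℝ) : (hessian (expSum α c) x).IsSymm := by
  ext i j
  simp [hessian, partialDeriv_expSum, mul_right_comm]

variable {α c}

theorem singularZeros_weights {x : Fin n → ℝ} (hx : x ∈ singularZeros (expSum α c)) :
    ∑ i, c i * Real.exp (α i ⬝ᵥ x) = 0 ∧
      ∀ j, ∑ i, c i * Real.exp (α i ⬝ᵥ x) * α i j = 0 := by
  refine ⟨hx.1, fun j => ?_⟩
  have := hx.2 j
  rw [partialDeriv_expSum] at this
  simpa [expSum, mul_right_comm] using this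

theorem weights_mem_orthant {ε : Fin m → SignType} (hc : c ∈ orthant ε) (x : Fin n → ℝ) :
    (fun i => c i * Real.exp (α i ⬝ᵥ x)) ∈ orthant ε := fun i => by
  rw [sign_mul, sign_pos (Real.exp_pos _), mul_one]
  exact hc i

theorem expSum_add (x v : Fin n → ℝ) :
    expSum α c (x + v) = ∑ i, c i * Real.exp (α i ⬝ᵥ x) * Real.exp (α i ⬝ᵥ v) := by
  simp [expSum, dotProduct_add, Real.exp_add, mul_assoc]

/-- At a singular zero the exponential sum attains its global maximum. -/
theorem expSum_nonpos_of_singularZero (P : Affine.Simplex ℝ (Fin n → ℝ) n)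
    {ε : Fin m → SignType} (hε : ∀ i, ε i = 1 ∨ ε i = -1)
    (hpos : posExponents α ε ⊆ simplexSet P) (hneg : negExponents α ε ⊆ negVertexCones P)
    (hc : c ∈ orthant ε) {x : Fin n → ℝ} (hx : x ∈ singularZeros (expSum α c))
    (z : Fin n → ℝ) : expSum α c z ≤ 0 := by
  obtain ⟨h0, h1⟩ := singularZeros_weights hx
  rw [← add_sub_cancel x z, expSum_add]
  refine sum_weight_mul_nonpos P (φ := Real.exp) (ψ := Real.exp) (fun a y h => ?_) hε hpos hneg
    (weights_mem_orthant hc x) h0 h1 (z - x)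
  have h2 := Real.add_one_lt_exp (sub_ne_zero.2 h)
  have h3 : Real.exp y = Real.exp a * Real.exp (y - a) := by rw [← Real.exp_add]; congr 1; ring
  have h4 := mul_lt_mul_of_pos_left h2 (Real.exp_pos a)
  linarith

theorem mem_singularZeros_of_nonpos (h : ∀ z, expSum α c z ≤ 0) {x : Fin n → ℝ}
    (hx : expSum α c x = 0) : x ∈ singularZeros (expSum α c) := by
  have hmax : IsLocalMax (expSum α c) x := Filter.Eventually.of_forall fun z => by
    rw [hx]; exact h z
  exact ⟨hx, fun i => by rw [partialDeriv, hmax.fderiv_eq_zero]; rfl⟩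

end Calculus

/-! ### The fibres of `Bᵀ Log |·|` on an orthant. -/

section GaleDual

variable {n m k : ℕ} {α : Fin m → Fin n → ℝ} {B : Matrix (Fin m) (Fin k) ℝ}

/-- Independent columns make the square matrix `Bᵀ B` injective, hence surjective. -/
theorem IsGaleDual.transpose_mulVec_surjective (hB : IsGaleDual α B) :
    Function.Surjective B.transpose.mulVec := by
  have hinj : Function.Injective (B.transpose * B).mulVecLin := by
    rw [← LinearMap.ker_eq_bot, Matrix.ker_mulVecLin_transpose_mul_self, LinearMap.ker_eq_bot]
    exact Matrix.mulVec_injective_iff.2 hB.1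
  intro y
  obtain ⟨x, hx⟩ := LinearMap.injective_iff_surjective.1 hinj y
  exact ⟨B.mulVec x, by rw [Matrix.mulVec_mulVec]; exact hx⟩

/-- The kernel of `Bᵀ` consists of the values of affine functions on the exponents. -/
theorem IsGaleDual.exists_affine (hB : IsGaleDual α B) {u : Fin m → ℝ}
    (hu : B.transpose.mulVec u = 0) : ∃ (s : ℝ) (x : Fin n → ℝ), ∀ i, u i = s + α i ⬝ᵥ x := by
  -- A functional vanishing on the kernel of `hatMatrix α` factors through it; the factor's values
  -- on the standard basis are `s` and `x`.
  have hmem : (dotProductBilin ℝ ℝ u : (Fin m → ℝ) →ₗ[ℝ] ℝ) ∈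
      LinearMap.range (hatMatrix α).mulVecLin.dualMap := by
    rw [LinearMap.range_dualMap_eq_dualAnnihilator_ker, Submodule.mem_dualAnnihilator, ← hB.2]
    intro z hz
    induction hz using Submodule.span_induction with
    | mem z hz =>
      obtain ⟨j, rfl⟩ := hz
      have := congrFun hu j
      rw [Matrix.mulVec, dotProduct_comm] at this
      exact this
    | zero => simp
    | add a b _ _ ha hb => rw [map_add, ha, hb, add_zero]
    | smul t a _ ha => rw [map_smul, ha, smul_zero]
  obtain ⟨g, hg⟩ := hmem
  refine ⟨g (Pi.single 0 1), fun j => g (Pi.single j.succ 1), fun i => ?_⟩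
  have h := LinearMap.congr_fun hg (Pi.single i 1)
  simp only [LinearMap.dualMap_apply, Matrix.mulVecLin_apply, Matrix.mulVec_single_one] at h
  have hcol : (hatMatrix α).col i =
      Pi.single 0 1 + ∑ j : Fin n, α i j • Pi.single (M := fun _ => ℝ) j.succ 1 := by
    ext r
    refine Fin.cases ?_ (fun l => ?_) r
    · simp [hatMatrix]
    · simp [hatMatrix, Pi.single_apply]
  rw [hcol, map_add, map_sum] at h
  simpa [dotProduct, eq_comm, Pi.single_apply] using h

theorem IsGaleDual.transpose_mulVec_dotProduct (hB : IsGaleDual α B) (x : Fin n → ℝ) :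
    (B.transpose.mulVec fun i => α i ⬝ᵥ x) = 0 := by
  ext j
  have hker : B.col j ∈ LinearMap.ker (hatMatrix α).mulVecLin :=
    hB.2 ▸ Submodule.subset_span ⟨j, rfl⟩
  have hrow : ∀ l : Fin n, ∑ i, B i j * α i l = 0 := fun l => by
    have := congrFun (LinearMap.mem_ker.1 hker) l.succ
    simpa [hatMatrix, Matrix.mulVec, dotProduct, mul_comm] using this
  simp only [Matrix.mulVec, dotProduct, Matrix.transpose_apply, Finset.mul_sum, ← mul_assoc,
    Pi.zero_apply]
  rw [Finset.sum_comm]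
  simp only [← Finset.sum_mul, hrow, zero_mul, Finset.sum_const_zero]

theorem IsGaleDual.transpose_mulVec_log_translate (hB : IsGaleDual α B) {c : Fin m → ℝ}
    (hc : ∀ i, c i ≠ 0) (x : Fin n → ℝ) :
    (B.transpose.mulVec fun i => Real.log |c i * Real.exp (α i ⬝ᵥ x)|) =
      B.transpose.mulVec fun i => Real.log |c i| := by
  have : (fun i => Real.log |c i * Real.exp (α i ⬝ᵥ x)|) =
      (fun i => Real.log |c i|) + fun i => α i ⬝ᵥ x := by
    ext i
    rw [abs_mul, Real.abs_exp, Real.log_mul (abs_ne_zero.2 (hc i)) (Real.exp_ne_zero _),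
      Real.log_exp, Pi.add_apply]
  rw [this, Matrix.mulVec_add, hB.transpose_mulVec_dotProduct, add_zero]

/-- Coefficient vectors with the same signs and the same image under `Bᵀ Log |·|` differ by a
translation of the variables and a positive factor. -/
theorem IsGaleDual.exists_translation (hB : IsGaleDual α B) {ε : Fin m → SignType}
    (hε : ∀ i, ε i = 1 ∨ ε i = -1) {c d : Fin m → ℝ} (hc : c ∈ orthant ε) (hd : d ∈ orthant ε)
    (h : (B.transpose.mulVec fun i => Real.log |c i|) =
      B.transpose.mulVec fun i => Real.log |d i|) :
    ∃ (s : ℝ) (x : Fin n → ℝ), ∀ z, expSum α c z = Real.exp s * expSum α d (x + z) := by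
  obtain ⟨s, x, hx⟩ := hB.exists_affine
    (u := (fun i => Real.log |c i|) - fun i => Real.log |d i|)
    (by rw [Matrix.mulVec_sub, h, sub_self])
  refine ⟨s, x, fun z => ?_⟩
  have hcd : ∀ i, c i = Real.exp s * (d i * Real.exp (α i ⬝ᵥ x)) := fun i => by
    have h1 : |c i| = Real.exp s * (|d i| * Real.exp (α i ⬝ᵥ x)) := by
      rw [← Real.exp_log (abs_pos.2 (ne_zero_of_mem_orthant hε hc i)),
        ← Real.exp_log (abs_pos.2 (ne_zero_of_mem_orthant hε hd i)), ← Real.exp_add, ← Real.exp_add]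
      congr 1
      have := hx i
      simp only [Pi.sub_apply] at this
      linarith
    rw [← sign_mul_abs (c i), ← sign_mul_abs (d i), h1, hc i, hd i]
    ring
  rw [expSum_add, Finset.mul_sum, expSum]
  exact Finset.sum_congr rfl fun i _ => by rw [hcd i]; ring

theorem IsGaleDual.exists_orthant_preimage (hB : IsGaleDual α B) {ε : Fin m → SignType}
    (hε : ∀ i, ε i = 1 ∨ ε i = -1) (y : Fin k → ℝ) :
    ∃ c ∈ orthant ε, (B.transpose.mulVec fun i => Real.log |c i|) = y := by
  obtain ⟨u, rfl⟩ := hB.transpose_mulVec_surjective y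
  refine ⟨fun i => (ε i : ℝ) * Real.exp (u i), fun i => ?_, ?_⟩
  · rw [sign_mul, sign_pos (Real.exp_pos _), mul_one]
    rcases hε i with h | h <;> simp [h]
  · congr 1
    ext i
    rcases hε i with h | h <;> simp [h]

end GaleDual

/-! ### Components of the complement of the discriminant. -/

section Components

theorem card_connectedComponents_le_two {X : Type*} [TopologicalSpace X] {S T : Set X}
    (hS : IsPreconnected S) (hT : IsPreconnected T) :
    ENat.card (ConnectedComponents ↥(S ∪ T)) ≤ 2 := by
  have hsub : ∀ {U : Set X}, IsPreconnected U → U ⊆ S ∪ T →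
      (ConnectedComponents.mk '' ((↑) ⁻¹' U : Set ↥(S ∪ T))).Subsingleton := by
    rintro U hU hUS _ ⟨a, ha, rfl⟩ _ ⟨b, hb, rfl⟩
    have hpre : IsPreconnected ((↑) ⁻¹' U : Set ↥(S ∪ T)) := by
      rw [← Topology.IsInducing.subtypeVal.isPreconnected_image, Subtype.image_preimage_coe,
        Set.inter_eq_right.2 hUS]
      exact hU
    exact (ConnectedComponents.coe_eq_coe'.2 (hpre.subset_connectedComponent hb ha))
  have hcover : (Set.univ : Set (ConnectedComponents ↥(S ∪ T))) ⊆
      ConnectedComponents.mk '' ((↑) ⁻¹' S) ∪ ConnectedComponents.mk '' ((↑) ⁻¹' T) := by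
    intro q _
    obtain ⟨a, rfl⟩ := ConnectedComponents.surjective_coe q
    rcases a.2 with h | h
    · exact Or.inl ⟨a, h, rfl⟩
    · exact Or.inr ⟨a, h, rfl⟩
  rw [← Set.encard_univ]
  calc _ ≤ _ := Set.encard_le_encard hcover
    _ ≤ _ := Set.encard_union_le _ _
    _ ≤ 1 + 1 := add_le_add (Set.encard_le_one_iff_subsingleton.2 (hsub hS Set.subset_union_left))
        (Set.encard_le_one_iff_subsingleton.2 (hsub hT Set.subset_union_right))
    _ = 2 := one_add_one_eq_two

variable {n m k : ℕ} {α : Fin m → Fin n → ℝ} {B : Matrix (Fin m) (Fin k) ℝ}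
  {ε : Fin m → SignType}

theorem convex_orthant (hε : ∀ i, ε i = 1 ∨ ε i = -1) : Convex ℝ (orthant ε) := by
  have : orthant ε = ⋂ i, (LinearMap.proj i : (Fin m → ℝ) →ₗ[ℝ] ℝ) ⁻¹'
      {t | SignType.sign t = ε i} := by
    ext c; simp [orthant]
  rw [this]
  refine convex_iInter fun i => Convex.linear_preimage ?_ _
  rcases hε i with h | h
  · simp only [h, sign_eq_one_iff]
    exact convex_Ioi (0 : ℝ)
  · simp only [h, sign_eq_neg_one_iff]
    exact convex_Iio (0 : ℝ)

theorem isPreconnected_image_log (hε : ∀ i, ε i = 1 ∨ ε i = -1) {C : Set (Fin m → ℝ)}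
    (hC : Convex ℝ C) (hsub : C ⊆ orthant ε) :
    IsPreconnected ((fun c : Fin m → ℝ => B.transpose.mulVec fun i => Real.log |c i|) '' C) := by
  have hlog : ContinuousOn (fun (c : Fin m → ℝ) i => Real.log |c i|) C :=
    continuousOn_pi.2 fun i => ContinuousOn.log (by fun_prop) fun c hc =>
      abs_ne_zero.2 (ne_zero_of_mem_orthant hε (hsub hc) i)
  have hlin : Continuous B.transpose.mulVecLin := LinearMap.continuous_of_finiteDimensional _
  exact hC.isPreconnected.image _ (hlin.comp_continuousOn hlog)

theorem expSum_combination (c d : Fin m → ℝ) (a b : ℝ) (x : Fin n → ℝ) :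
    expSum α (a • c + b • d) x = a * expSum α c x + b * expSum α d x := by
  simp only [expSum, Finset.mul_sum, ← Finset.sum_add_distrib, Pi.add_apply, Pi.smul_apply,
    smul_eq_mul]
  exact Finset.sum_congr rfl fun i _ => by ring

/-- The complement of the signed reduced discriminant splits into the classes of exponential sums
that are positive somewhere (after a translation, at the origin) and those that are negative
everywhere. -/
theorem compl_signedReducedDiscriminant (P : Affine.Simplex ℝ (Fin n → ℝ) n)
    (hε : ∀ i, ε i = 1 ∨ ε i = -1) (hB : IsGaleDual α B)
    (hpos : posExponents α ε ⊆ simplexSet P) (hneg : negExponents α ε ⊆ negVertexCones P) :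
    (signedReducedDiscriminant α ε B)ᶜ =
      (fun c : Fin m → ℝ => B.transpose.mulVec fun i => Real.log |c i|) ''
          {c | c ∈ orthant ε ∧ 0 < expSum α c 0} ∪
        (fun c : Fin m → ℝ => B.transpose.mulVec fun i => Real.log |c i|) ''
          {c | c ∈ orthant ε ∧ ∀ x, expSum α c x < 0} := by
  ext y
  constructor
  · intro hy
    obtain ⟨c, hc, rfl⟩ := hB.exists_orthant_preimage hε y
    by_cases h : ∃ x, 0 < expSum α c x
    · obtain ⟨x, hx⟩ := h
      -- Translating the positive point to the origin turns positivity into one linear condition on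
      -- the coefficients, hence a convex one.
      refine Or.inl ⟨_, ⟨weights_mem_orthant (α := α) hc x, ?_⟩, ?_⟩
      · simpa [expSum] using hx
      · exact hB.transpose_mulVec_log_translate (ne_zero_of_mem_orthant hε hc) x
    · push Not at h
      refine Or.inr ⟨c, ⟨hc, fun x => lt_of_le_of_ne (h x) fun h0 => hy ?_⟩, rfl⟩
      exact ⟨c, ⟨hc, x, mem_singularZeros_of_nonpos h h0⟩, rfl⟩
  · rintro (⟨c, ⟨hc, h⟩, rfl⟩ | ⟨c, ⟨hc, h⟩, rfl⟩) ⟨d, ⟨hd, x, hx⟩, hdc⟩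
    · obtain ⟨s, u, hsu⟩ := hB.exists_translation hε hc hd hdc.symm
      rw [hsu] at h
      exact absurd (expSum_nonpos_of_singularZero P hε hpos hneg hd hx (u + 0))
        (not_le.2 (pos_of_mul_pos_right h (Real.exp_pos s).le))
    · obtain ⟨s, u, hsu⟩ := hB.exists_translation hε hc hd hdc.symm
      have := h (x - u)
      rw [hsu, add_sub_cancel, hx.1, mul_zero] at this
      exact lt_irrefl _ this

theorem card_components_compl_signedReducedDiscriminant_le
    (P : Affine.Simplex ℝ (Fin n → ℝ) n)
    (hε : ∀ i, ε i = 1 ∨ ε i = -1) (hB : IsGaleDual α B)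
    (hpos : posExponents α ε ⊆ simplexSet P) (hneg : negExponents α ε ⊆ negVertexCones P) :
    ENat.card (ConnectedComponents ↥((signedReducedDiscriminant α ε B)ᶜ)) ≤ 2 := by
  rw [compl_signedReducedDiscriminant P hε hB hpos hneg]
  refine card_connectedComponents_le_two
    (isPreconnected_image_log hε ?_ fun c hc => hc.1)
    (isPreconnected_image_log hε ?_ fun c hc => hc.1)
  · rintro c ⟨hc, h⟩ d ⟨hd, h'⟩ a b ha hb hab
    refine ⟨convex_orthant hε hc hd ha hb hab, ?_⟩
    rw [expSum_combination]
    exact convex_Ioi (0 : ℝ) h h' ha hb hab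
  · rintro c ⟨hc, h⟩ d ⟨hd, h'⟩ a b ha hb hab
    refine ⟨convex_orthant hε hc hd ha hb hab, fun x => ?_⟩
    rw [expSum_combination]
    exact convex_Iio (0 : ℝ) (h x) (h' x) ha hb hab

end Components

/-! ### Definiteness of the Hessian and its eigenvalues. -/

theorem posDef_neg_hessian {n m : ℕ} (P : Affine.Simplex ℝ (Fin n → ℝ) n)
    {α : Fin m → Fin n → ℝ} (hα : Function.Injective α) {ε : Fin m → SignType}
    (hε : ∀ i, ε i = 1 ∨ ε i = -1) (hpos : posExponents α ε ⊆ simplexSet P)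
    (hneg : negExponents α ε ⊆ negVertexCones P)
    (hint : (Set.range α ∩ interior (simplexSet P ∪ negVertexCones P)).Nonempty)
    {c : Fin m → ℝ} (hc : c ∈ orthant ε) {x : Fin n → ℝ}
    (hx : x ∈ singularZeros (expSum α c)) : (-hessian (expSum α c) x).PosDef := by
  refine Matrix.PosDef.of_dotProduct_mulVec_pos ?_ fun v hv => ?_
  · rw [Matrix.IsHermitian, Matrix.conjTranspose_eq_transpose_of_trivial, Matrix.transpose_neg,
      hessian_isSymm]
  · obtain ⟨h0, h1⟩ := singularZeros_weights hx
    rw [star_trivial, Matrix.neg_mulVec, dotProduct_neg, dotProduct_hessian_mulVec, neg_pos]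
    exact sum_weight_mul_sq_neg P hα hε hpos hneg hint (weights_mem_orthant hc x) h0 h1 hv

theorem eigenvalue_neg_of_posDef_neg {n : ℕ} {H : Matrix (Fin n) (Fin n) ℝ} (hH : (-H).PosDef)
    {μ : ℝ} (hμ : Module.End.HasEigenvalue (Matrix.toLin' H) μ) : μ < 0 := by
  obtain ⟨v, hv⟩ := hμ.exists_hasEigenvector
  have h := hH.dotProduct_mulVec_pos hv.2
  have he : H.mulVec v = μ • v := by simpa using hv.apply_eq_smul
  rw [star_trivial, Matrix.neg_mulVec, he, dotProduct_neg, dotProduct_smul, smul_eq_mul,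
    neg_pos] at h
  exact neg_of_mul_neg_left h (Finset.sum_nonneg fun i _ => mul_self_nonneg (v i))

end ExpSum

theorem theorem4p10 {n k : ℕ}
    (P : Affine.Simplex ℝ (Fin n → ℝ) n)
    (α : Fin (n + k + 1) → Fin n → ℝ) (hα : Function.Injective α)
    (ε : Fin (n + k + 1) → SignType) (hε : ∀ i, ε i = 1 ∨ ε i = -1)
    (hfull : ExpSum.FullDimensional α)
    (B : Matrix (Fin (n + k + 1)) (Fin k) ℝ) (hB : ExpSum.IsGaleDual α B)
    (hpos : ExpSum.posExponents α ε ⊆ ExpSum.simplexSet P)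
    (hneg : ExpSum.negExponents α ε ⊆ ExpSum.negVertexCones P)
    (hint : (Set.range α ∩
      interior (ExpSum.simplexSet P ∪ ExpSum.negVertexCones P)).Nonempty) :
    (∀ c ∈ ExpSum.orthant ε, ∀ x ∈ ExpSum.singularZeros (ExpSum.expSum α c),
      (-ExpSum.hessian (ExpSum.expSum α c) x).PosDef ∧
      ∀ μ : ℝ, Module.End.HasEigenvalue
        (Matrix.toLin' (ExpSum.hessian (ExpSum.expSum α c) x)) μ → μ < 0) ∧
    (k = 2 →
      ENat.card (ConnectedComponents ↥((ExpSum.signedReducedDiscriminant α ε B)ᶜ)) ≤ 2) := by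
  refine ⟨fun c hc x hx => ?_, fun _ => ?_⟩
  · have h := ExpSum.posDef_neg_hessian P hα hε hpos hneg hint hc hx
    exact ⟨h, fun μ hμ => ExpSum.eigenvalue_neg_of_posDef_neg h hμ⟩
  · exact ExpSum.card_components_compl_signedReducedDiscriminant_le P hε hB hpos hneg
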